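/- Let $d\in\mathbb N$ and let $|\cdot|$ denote the Euclidean norm on $\mathbb{R}^d$ and the corresponding operator norm. A $C^1$ map $\varphi:\Omega\to\mathbb{R}^d$ on an open set $\Omega\subset\mathbb{R}^d$ is *conformal* if $|\varphi'(x)y|=|\varphi'(x)||y|\neq 0$ for all $x\in\Omega$ and $y\in\mathbb{R}^d\setminus\{0\}$, and there are $\alpha,c>0$ with $|\varphi'(x)-\varphi'(y)|\le c|x-y|^\alpha$ for all $x,y\in\Omega$. A family $\{\varphi_i\}_{i=1}^N$, $N\ge 2$, is a *conformal iterated function system* if there is a bounded open convex set $\Omega\subset\mathbb{R}^d$ such that each $\varphi_i:\Omega\to\mathbb{R}^d$ is an injective conformal map with $\overline{\varphi_i(\Omega)}\subset\Omega$ and $\sup_{x\in\Omega}|\varphi_i'(x)|<1$. The associated *self-conformal set* is the unique non-empty compact set $F\subset\Omega$ with $F=\bigcup_{i=1}^N\varphi_i(F)$. No separation condition is assumed. For $s\ge 0$, $0<\delta\le\infty$ and $A\subset\mathbb{R}^d$ let $\mathcal{H}^s_\delta(A)=\inf\{\sum_i \operatorname{diam}(U_i)^s\}$, the infimum being over all countable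 covers $\{U_i\}_i$ of $A$ by non-empty sets with $\operatorname{diam}(U_i)\le\delta$ (with $0^0=1$); let $\mathcal{H}^s(A)=\sup_{\delta>0}\mathcal{H}^s_\delta(A)$ be the Hausdorff measure, $\mathcal{H}^s_\infty$ the Hausdorff content, and $\dim_{\mathrm H}(A)=\inf\{s\ge0:\mathcal{H}^s(A)=0\}$ the Hausdorff dimension. A set $A\subset\mathbb{R}^d$ is *Ahlfors $s$-regular* if there are a Radon measure $\mu$ supported on $A$ and a constant $C\ge1$ such that $C^{-1}r^s\le\mu(B(x,r))\le Cr^s$ for all $x\in A$ and $0<r<\operatorname{diam}(A)$, where $B(x,r)$ is the closed ball. **Theorem.** Let $F\subset\mathbb{R}^d$ be a self-conformal set and $s=\dim_{\mathrm H}(F)$. Then there exists a constant $C\ge1$ such that $$\mathcal{H}^s(F\cap A)\le C\,\mathcal{H}^s_\infty(F\cap A)\qquad\text{for all } A\subset\mathbb{R}^d.$$ Furthermore, $\mathcal{H}^s(F)>0$ if and only if $F$ is Ahlfors $s$-regular. -/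

import Mathlib

open MeasureTheory Set
open scoped ENNReal NNReal MeasureTheory

/-- The `s`-dimensional Hausdorff `δ`-content
`H^s_δ(A) = inf {∑ᵢ diam(Uᵢ)^s : A ⊆ ⋃ᵢ Uᵢ, diam(Uᵢ) ≤ δ}`. Covers are indexed by `ℕ`; an empty
covering set contributes `0` (also when `s = 0`), so that finite covers are included, and a
one-point covering set contributes `1` when `s = 0`. -/
noncomputable def hausdorffDeltaContent {X : Type*} [MetricSpace X]
    (δ : ℝ≥0∞) (s : ℝ) (A : Set X) : ℝ≥0∞ :=
  ⨅ (U : ℕ → Set X) (_ : A ⊆ ⋃ n, U n) (_ : ∀ n, Metric.ediam (U n) ≤ δ),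
    ∑' n, ⨆ _ : (U n).Nonempty, Metric.ediam (U n) ^ s

/-- The Hausdorff content `H^s_∞`. -/
noncomputable def hausdorffContent {X : Type*} [MetricSpace X] (s : ℝ) (A : Set X) : ℝ≥0∞ :=
  hausdorffDeltaContent ∞ s A

/-- Mathlib's Hausdorff measure is the supremum of these `δ`-contents. -/
theorem hausdorffMeasure_eq_iSup_hausdorffDeltaContent {X : Type*} [MetricSpace X]
    [MeasurableSpace X] [BorelSpace X] (s : ℝ) (A : Set X) :
    μH[s] A = ⨆ (δ : ℝ≥0∞) (_ : 0 < δ), hausdorffDeltaContent δ s A :=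
  Measure.hausdorffMeasure_apply s A

/-- `A` is Ahlfors `s`-regular: there are a Radon measure `μ` supported on `A` and `C ≥ 1` with
`C⁻¹ r^s ≤ μ(B(x,r)) ≤ C r^s` for all `x ∈ A` and `0 < r < diam(A)`. The diameter is taken in
`[0,∞]`. -/
def IsAhlforsRegular {d : ℕ} (s : ℝ) (A : Set (EuclideanSpace ℝ (Fin d))) : Prop :=
  ∃ μ : Measure (EuclideanSpace ℝ (Fin d)), μ.Regular ∧ μ Aᶜ = 0 ∧
    ∃ C : ℝ, 1 ≤ C ∧ ∀ x ∈ A, ∀ r : ℝ, 0 < r → ENNReal.ofReal r < Metric.ediam A →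
      ENNReal.ofReal (C⁻¹ * r ^ s) ≤ μ (Metric.closedBall x r) ∧
        μ (Metric.closedBall x r) ≤ ENNReal.ofReal (C * r ^ s)

/-- `f` is conformal on the open set `Ω` of `ℝ^d`: it is `C¹` there, its differential at every
point of `Ω` is a similarity, and the differential is Hölder continuous on `Ω`. -/
structure IsConformalOn {d : ℕ} (f : EuclideanSpace ℝ (Fin d) → EuclideanSpace ℝ (Fin d))
    (Ω : Set (EuclideanSpace ℝ (Fin d))) : Prop where
  contDiffOn : ContDiffOn ℝ 1 f Ω
  similarity : ∀ x ∈ Ω, ∀ y : EuclideanSpace ℝ (Fin d), y ≠ 0 →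
    ‖fderiv ℝ f x y‖ = ‖fderiv ℝ f x‖ * ‖y‖ ∧ ‖fderiv ℝ f x y‖ ≠ 0
  holder : ∃ α c : ℝ, 0 < α ∧ 0 < c ∧ ∀ x ∈ Ω, ∀ y ∈ Ω,
    ‖fderiv ℝ f x - fderiv ℝ f y‖ ≤ c * ‖x - y‖ ^ α

/-- `φ₁, …, φ_N`, `N ≥ 2`, is a conformal iterated function system on the bounded open convex
set `Ω`. Only the restrictions of the maps to `Ω` matter. The supremum in `contracting` is taken
in `[0,∞]`. -/
structure IsConformalIFS {d N : ℕ} (Ω : Set (EuclideanSpace ℝ (Fin d)))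
    (φ : Fin N → EuclideanSpace ℝ (Fin d) → EuclideanSpace ℝ (Fin d)) : Prop where
  two_le : 2 ≤ N
  isOpen : IsOpen Ω
  convex : Convex ℝ Ω
  bounded : Bornology.IsBounded Ω
  injOn : ∀ i, InjOn (φ i) Ω
  conformal : ∀ i, IsConformalOn (φ i) Ω
  closure_image_subset : ∀ i, closure (φ i '' Ω) ⊆ Ω
  contracting : ∀ i, ⨆ x ∈ Ω, ‖fderiv ℝ (φ i) x‖ₑ < 1

/-- `F` is a self-conformal set: it is the non-empty compact set `F ⊆ Ω` with `F = ⋃ᵢ φᵢ(F)` for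
some conformal iterated function system on some `Ω`. -/
def IsSelfConformal {d : ℕ} (F : Set (EuclideanSpace ℝ (Fin d))) : Prop :=
  ∃ (N : ℕ) (Ω : Set (EuclideanSpace ℝ (Fin d)))
    (φ : Fin N → EuclideanSpace ℝ (Fin d) → EuclideanSpace ℝ (Fin d)),
    IsConformalIFS Ω φ ∧ F.Nonempty ∧ IsCompact F ∧ F ⊆ Ω ∧ F = ⋃ i, φ i '' F

open Metric Filter Topology

/-! Everything reduces to the single bound `μH[s] V ≤ D ^ s * ediam V ^ s` for subsets `V` of `F`.
Summed over a cover it compares measure with content; applied to balls it is the upper half of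
Ahlfors regularity.

Conformality enters only through quasi self-similarity. Bounded distortion makes each composition of
the maps a similarity up to a fixed factor, and stopping the coding of a point at the right word
gives a copy of `F` through that point at any prescribed scale
(`exists_isQuasiSelfSimilar_of_distortion`). From there on only metric spaces are involved.

The first consequence is that `μH[s]` is finite. If there were more than `(D / r) ^ s` separated
copies of scale `r`, they would generate a Cantor-type construction of dimension larger than `s`
(`card_le_rpow_dimH_of_separated`). So packings at scale `r`, and hence covers, have at most `(D /
r) ^ s` members.

The second is the density bound, `hausdorffMeasure_le_mul_ediam_rpow`. Suppose a closed `V` violates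
it. Every small copy of `V` is then covered by itself at a cost of at most `ε < 1` times its
measure. By Vitali's theorem, disjoint copies of `V` inside any open set account for a fixed
proportion of its content, and exhausting the rest in the same way shows that every `δ`-content of
the space is at most `ε` times its measure. Letting `δ → 0` contradicts `0 < μH[s] univ < ∞`. No
separation condition is needed, because the disjointness comes from Vitali's theorem. -/

/-- A metric space all of whose balls contain a rescaled copy of the whole space, up to the
distortion constant `D`. -/
def IsQuasiSelfSimilar (X : Type*) [MetricSpace X] (D : ℝ≥0) : Prop :=
  ∀ (x : X) (r : ℝ≥0), 0 < r → r ≤ 1 →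
    ∃ g : X → X, x ∈ range g ∧ LipschitzWith r g ∧ AntilipschitzWith (D / r) g

/-! ### Separated copies and a lower bound for the dimension -/

section Covers

variable {X : Type*} [MetricSpace X] {ι : Type*} [Fintype ι] [Nontrivial ι] {g : ι → X → X}
  {K : ℝ≥0} {t : ℝ} {η : ℝ≥0∞}

/-- If the space contains sufficiently many separated expanded copies of itself, then each finite
cover pulls back to a more efficient one with fewer sets, so that no finite cover is efficient. -/
theorem rpow_le_sum_ediam_rpow_of_separated [Nonempty X] (hg : ∀ i, AntilipschitzWith K (g i))
    (ht : 0 < t) (hcard : (K : ℝ≥0∞) ^ t ≤ Fintype.card ι)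
    (hη : ∀ i j, i ≠ j → ∀ x y, η ≤ edist (g i x) (g j y))
    {κ : Type*} (J : Finset κ) (U : κ → Set X) (hU : ∀ x, ∃ j ∈ J, x ∈ U j) :
    η ^ t ≤ ∑ j ∈ J, ediam (U j) ^ t := by
  classical
  induction hn : J.card using Nat.strong_induction_on generalizing J U with
  | _ n IH =>
  subst hn
  by_contra! hlt
  -- A covering set of diameter below the gap `η` meets at most one copy, so the subfamilies `S i`
  -- that meet the different copies are disjoint.
  have hsmall : ∀ j ∈ J, ediam (U j) < η := fun j hj => by
    by_contra! h
    exact absurd ((ENNReal.rpow_le_rpow h ht.le).trans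
      (Finset.single_le_sum (f := fun j => ediam (U j) ^ t) (fun _ _ => zero_le) hj)) hlt.not_ge
  let S : ι → Finset κ := fun i => J.filter fun j => (U j ∩ range (g i)).Nonempty
  have hS : ∀ i j, i ≠ j → Disjoint (S i) (S j) := by
    intro i i' hii
    refine Finset.disjoint_left.2 fun j hj hj' => ?_
    obtain ⟨_, hx, a, rfl⟩ := (Finset.mem_filter.1 hj).2
    obtain ⟨_, hy, b, rfl⟩ := (Finset.mem_filter.1 hj').2
    exact absurd ((hη i i' hii a b).trans (edist_le_ediam_of_mem hx hy))
      (hsmall j (Finset.mem_filter.1 hj).1).not_ge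
  have hcov : ∀ i x, ∃ j ∈ S i, x ∈ g i ⁻¹' U j := fun i x => by
    obtain ⟨j, hj, hx⟩ := hU (g i x)
    exact ⟨j, Finset.mem_filter.2 ⟨hj, _, hx, x, rfl⟩, hx⟩
  have hne : ∀ i, (S i).Nonempty := fun i => by
    obtain ⟨j, hj, -⟩ := hcov i (Classical.arbitrary X)
    exact ⟨j, hj⟩
  -- There is a second copy, and the sets meeting it are absent from `S i`; this makes the induction
  -- descend.
  have hlt' : ∀ i, (S i).card < J.card := fun i => by
    obtain ⟨i', hi'⟩ := exists_ne i
    refine Finset.card_lt_card ⟨Finset.filter_subset _ _, fun h => ?_⟩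
    obtain ⟨j, hj⟩ := hne i'
    exact Finset.disjoint_left.1 (hS _ _ hi') hj (h (Finset.mem_filter.1 hj).1)
  have key : ∀ i, η ^ t ≤ (K : ℝ≥0∞) ^ t * ∑ j ∈ S i, ediam (U j) ^ t := fun i => by
    refine (IH _ (hlt' i) (S i) (fun j => g i ⁻¹' U j) (hcov i) rfl).trans ?_
    rw [Finset.mul_sum]
    refine Finset.sum_le_sum fun j _ => ?_
    rw [← ENNReal.mul_rpow_of_nonneg _ _ ht.le]
    exact ENNReal.rpow_le_rpow ((hg i).ediam_preimage_le _) ht.le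
  have hsum : ∑ i, ∑ j ∈ S i, ediam (U j) ^ t ≤ ∑ j ∈ J, ediam (U j) ^ t := by
    rw [← Finset.sum_biUnion fun i _ j _ hij => hS i j hij]
    exact Finset.sum_le_sum_of_subset (Finset.biUnion_subset.2 fun i _ => Finset.filter_subset _ _)
  have h1 : (Fintype.card ι : ℝ≥0∞) * η ^ t
      ≤ (K : ℝ≥0∞) ^ t * ∑ j ∈ J, ediam (U j) ^ t := by
    calc (Fintype.card ι : ℝ≥0∞) * η ^ t = ∑ _i : ι, η ^ t := by simp
      _ ≤ ∑ i, (K : ℝ≥0∞) ^ t * ∑ j ∈ S i, ediam (U j) ^ t := Finset.sum_le_sum fun i _ => key i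
      _ ≤ _ := by rw [← Finset.mul_sum]; gcongr
  have hK : (K : ℝ≥0∞) ^ t ≠ ∞ := ENNReal.rpow_ne_top_of_nonneg ht.le ENNReal.coe_ne_top
  have hc : (Fintype.card ι : ℝ≥0∞) ≠ 0 := by simp
  have h2 : (Fintype.card ι : ℝ≥0∞) * η ^ t
      ≤ (Fintype.card ι : ℝ≥0∞) * ∑ j ∈ J, ediam (U j) ^ t := h1.trans (by gcongr)
  exact absurd ((ENNReal.mul_le_mul_iff_right hc (by simp)).1 h2) hlt.not_ge

/-- Open sets can be used in covers at no additional cost. -/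
theorem exists_isOpen_superset_ediam_rpow_le {X : Type*} [MetricSpace X] [BoundedSpace X] {t : ℝ}
    (ht : 0 < t) {ε : ℝ≥0∞} (hε : ε ≠ 0) (U : Set X) :
    ∃ V, IsOpen V ∧ U ⊆ V ∧ ediam V ^ t ≤ ediam U ^ t + ε := by
  have hU : ediam U ^ t ≠ ∞ :=
    ENNReal.rpow_ne_top_of_nonneg ht.le (Bornology.IsBounded.all U).ediam_ne_top
  have hlim : Tendsto (fun ρ : ℝ≥0 => (ediam U + 2 * (ρ : ℝ≥0∞)) ^ t) (𝓝[>] 0)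
      (𝓝 ((ediam U + 2 * ((0 : ℝ≥0) : ℝ≥0∞)) ^ t)) := by
    refine Tendsto.mono_left ?_ nhdsWithin_le_nhds
    refine (Continuous.tendsto ?_ (0 : ℝ≥0))
    refine (ENNReal.continuous_rpow_const).comp (continuous_const.add ?_)
    exact (ENNReal.continuous_const_mul (by simp)).comp ENNReal.continuous_coe
  have hev := hlim.eventually_lt_const (u := ediam U ^ t + ε)
    (by simpa using ENNReal.lt_add_right hU hε)
  obtain ⟨ρ, hρ, hρ0⟩ := (hev.and self_mem_nhdsWithin).exists
  refine ⟨thickening ρ U, isOpen_thickening, self_subset_thickening (by exact_mod_cast hρ0) U, ?_⟩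
  exact (ENNReal.rpow_le_rpow (ediam_thickening_le ρ) ht.le).trans hρ.le

/-- Compactness reduces countable covers to finite ones, after each covering set is enlarged to an
open set with summable errors; `η ^ t` then bounds even the content at `δ = ∞` from below. -/
theorem hausdorffMeasure_univ_ne_zero_of_separated [CompactSpace X] [Nonempty X]
    [MeasurableSpace X] [BorelSpace X] (hg : ∀ i, AntilipschitzWith K (g i))
    (ht : 0 < t) (hcard : (K : ℝ≥0∞) ^ t ≤ Fintype.card ι)
    (hη : ∀ i j, i ≠ j → ∀ x y, η ≤ edist (g i x) (g j y)) (hη' : η ≠ ∞) (hη0 : η ≠ 0) :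
    μH[t] (univ : Set X) ≠ 0 := by
  have hpos : 0 < η ^ t := ENNReal.rpow_pos (pos_iff_ne_zero.2 hη0) hη'
  refine (hpos.trans_le ?_).ne'
  rw [Measure.hausdorffMeasure_apply]
  refine le_iSup₂_of_le ∞ (by simp) (le_iInf fun U => le_iInf fun hU => le_iInf fun _ => ?_)
  refine ENNReal.le_of_forall_pos_le_add fun ε hε _ => ?_
  obtain ⟨ε', hε', hsum⟩ := ENNReal.exists_pos_sum_of_countable (ENNReal.coe_pos.2 hε).ne' ℕ
  have hV : ∀ n, ∃ V, IsOpen V ∧ U n ⊆ V ∧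
      ediam V ^ t ≤ (⨆ _ : (U n).Nonempty, ediam (U n) ^ t) + ε' n := fun n => by
    rcases (U n).eq_empty_or_nonempty with h | h
    · exact ⟨∅, isOpen_empty, h.subset, by simp [ENNReal.zero_rpow_of_pos ht]⟩
    · simpa [h] using exists_isOpen_superset_ediam_rpow_le ht
        (ENNReal.coe_pos.2 (hε' n)).ne' (U n)
  choose V hVo hUV hVd using hV
  obtain ⟨J, hJ⟩ := isCompact_univ.elim_finite_subcover V hVo
    (hU.trans (iUnion_mono hUV))
  calc η ^ t ≤ ∑ n ∈ J, ediam (V n) ^ t :=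
        rpow_le_sum_ediam_rpow_of_separated hg ht hcard hη J V
          fun x => by simpa using hJ (mem_univ x)
    _ ≤ ∑' n, ediam (V n) ^ t := ENNReal.sum_le_tsum J
    _ ≤ ∑' n, ((⨆ _ : (U n).Nonempty, ediam (U n) ^ t) + ε' n) := ENNReal.tsum_le_tsum hVd
    _ ≤ _ := by rw [ENNReal.tsum_add]; gcongr

/-- If the number of copies exceeded `K ^ s`, it would still exceed `K ^ t` for some `t > s` by
continuity, and the positive `t`-measure would push the dimension up to `t`. -/
theorem card_le_rpow_dimH_of_separated [CompactSpace X] [Nonempty X]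
    (hg : ∀ i, AntilipschitzWith K (g i)) {s : ℝ≥0} (hs : dimH (univ : Set X) = s)
    (hη : ∀ i j, i ≠ j → ∀ x y, η ≤ edist (g i x) (g j y)) (hη' : η ≠ ∞) (hη0 : η ≠ 0) :
    (Fintype.card ι : ℝ≥0∞) ≤ (K : ℝ≥0∞) ^ (s : ℝ) := by
  borelize X
  by_contra! hlt
  have hK : K ≠ 0 := by
    rintro rfl
    obtain ⟨i, j, hij⟩ := exists_pair_ne ι
    have hsub : Subsingleton X := ⟨fun x y => edist_eq_zero.1 <| by
      simpa using (hg i) x y⟩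
    have h := hη i j hij (Classical.arbitrary X) (Classical.arbitrary X)
    rw [Subsingleton.elim (g i _) (g j (Classical.arbitrary X)), edist_self] at h
    exact hη0 (le_zero_iff.1 h)
  have hcont : Tendsto (fun t : ℝ => (K : ℝ≥0∞) ^ t) (𝓝 (s : ℝ)) (𝓝 ((K : ℝ≥0∞) ^ (s : ℝ))) := by
    simp_rw [← ENNReal.coe_rpow_of_ne_zero hK]
    exact ENNReal.tendsto_coe.2 (tendsto_const_nhds.nnrpow tendsto_id (Or.inl hK))
  have hev : ∀ᶠ t : ℝ in 𝓝[>] (s : ℝ), (K : ℝ≥0∞) ^ t < Fintype.card ι :=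
    nhdsWithin_le_nhds (hcont.eventually_lt_const hlt)
  obtain ⟨t, ht, hst⟩ := (hev.and self_mem_nhdsWithin).exists
  have hst' : (s : ℝ) < t := hst
  lift t to ℝ≥0 using s.coe_nonneg.trans hst'.le
  have h := le_dimH_of_hausdorffMeasure_ne_zero (hausdorffMeasure_univ_ne_zero_of_separated hg
    (s.coe_nonneg.trans_lt hst') ht.le hη hη' hη0)
  rw [hs] at h
  exact absurd (ENNReal.coe_le_coe.1 h) (not_le.2 (by exact_mod_cast hst'))

end Covers

/-! ### Packing bounds and finiteness of the measure -/

namespace IsQuasiSelfSimilar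

variable {X : Type*} [MetricSpace X] [CompactSpace X] [Nonempty X] {D Δ s : ℝ≥0}

/-- The copy of scale `r` through a point lies within `r * Δ` of that point, so points `3 * r * Δ`
apart carry copies `r * Δ` apart. -/
theorem card_le_of_separated (hX : IsQuasiSelfSimilar X D) (hD : 1 ≤ D)
    (hs : dimH (univ : Set X) = s) (hΔ : ∀ x y : X, edist x y ≤ Δ) (hΔ0 : 0 < Δ) {r : ℝ≥0}
    (hr0 : 0 < r) (hr1 : r ≤ 1) (T : Finset X)
    (hT : ∀ x ∈ T, ∀ y ∈ T, x ≠ y → 3 * (r * Δ : ℝ≥0∞) ≤ edist x y) :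
    (T.card : ℝ≥0∞) ≤ ((D / r : ℝ≥0) : ℝ≥0∞) ^ (s : ℝ) := by
  have h1 : 1 ≤ ((D / r : ℝ≥0) : ℝ≥0∞) :=
    ENNReal.one_le_coe_iff.2 ((one_le_div hr0).2 (hr1.trans hD))
  rcases le_or_gt T.card 1 with hc | hc
  · calc (T.card : ℝ≥0∞) ≤ 1 := by exact_mod_cast hc
      _ = 1 ^ (s : ℝ) := (ENNReal.one_rpow _).symm
      _ ≤ _ := ENNReal.rpow_le_rpow h1 s.coe_nonneg
  have : Nontrivial T := (Fintype.one_lt_card_iff_nontrivial).1 (by simpa using hc)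
  choose g hg hgL hgA using fun x : T => hX x r hr0 hr1
  have hgd : ∀ (x : T) a, edist (g x a) x ≤ r * Δ := fun x a => by
    obtain ⟨b, hb⟩ := hg x
    rw [← hb]
    exact (hgL x a b).trans (by gcongr; exact hΔ a b)
  have hrΔ : (r * Δ : ℝ≥0∞) ≠ ∞ := by finiteness
  have := card_le_rpow_dimH_of_separated (η := r * Δ) hgA hs ?_ hrΔ ?_
  · simpa using this
  · intro x y hxy a b
    have h3 := hT x x.2 y y.2 (fun h => hxy (Subtype.ext h))
    have h4 : edist (x : X) y ≤ r * Δ + edist (g x a) (g y b) + r * Δ :=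
      (edist_triangle4 (x : X) (g x a) (g y b) y).trans
        (add_le_add (add_le_add (edist_comm (x : X) _ ▸ hgd x a) le_rfl) (hgd y b))
    have h5 : (r * Δ : ℝ≥0∞) + (r * Δ + r * Δ) ≤ edist (g x a) (g y b) + (r * Δ + r * Δ) :=
      calc (r * Δ : ℝ≥0∞) + (r * Δ + r * Δ) = 3 * (r * Δ) := by ring
        _ ≤ _ := h3.trans h4
        _ = _ := by ring
    exact (ENNReal.add_le_add_iff_right (by finiteness)).1 h5
  · simp [hr0.ne', hΔ0.ne']

/-- A separated set of maximal cardinality is a net; the packing bound guarantees that the maximum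
exists. -/
theorem exists_finset_cover (hX : IsQuasiSelfSimilar X D) (hD : 1 ≤ D)
    (hs : dimH (univ : Set X) = s) (hΔ : ∀ x y : X, edist x y ≤ Δ) (hΔ0 : 0 < Δ) {r : ℝ≥0}
    (hr0 : 0 < r) (hr1 : r ≤ 1) :
    ∃ T : Finset X, (T.card : ℝ≥0∞) ≤ ((D / r : ℝ≥0) : ℝ≥0∞) ^ (s : ℝ) ∧
      ∀ x, ∃ y ∈ T, edist x y ≤ 3 * (r * Δ : ℝ≥0∞) := by
  classical
  let S : Set ℕ := {n | ∃ T : Finset X, T.card = n ∧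
    ∀ x ∈ T, ∀ y ∈ T, x ≠ y → 3 * (r * Δ : ℝ≥0∞) ≤ edist x y}
  have hSne : S.Nonempty := ⟨0, ∅, by simp⟩
  have hSb : BddAbove S := by
    obtain ⟨n, hn⟩ := ENNReal.exists_nat_gt
      (ENNReal.rpow_ne_top_of_nonneg s.coe_nonneg (ENNReal.coe_ne_top (r := D / r)))
    refine ⟨n, ?_⟩
    rintro _ ⟨T, rfl, hT⟩
    exact_mod_cast (hX.card_le_of_separated hD hs hΔ hΔ0 hr0 hr1 T hT).trans hn.le
  obtain ⟨T, hTc, hT⟩ := Nat.sSup_mem hSne hSb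
  refine ⟨T, hX.card_le_of_separated hD hs hΔ hΔ0 hr0 hr1 T hT, fun x => ?_⟩
  by_contra! hx
  have hxT : x ∉ T := fun h => by simpa using hx x h
  have hmem : T.card + 1 ∈ S := by
    refine ⟨insert x T, Finset.card_insert_of_notMem hxT, fun a ha b hb hab => ?_⟩
    rcases Finset.mem_insert.1 ha with ha' | ha' <;> rcases Finset.mem_insert.1 hb with hb' | hb'
    · exact absurd (ha'.trans hb'.symm) hab
    · exact ha' ▸ (hx b hb').le
    · rw [edist_comm]
      exact hb' ▸ (hx a ha').le
    · exact hT a ha' b hb' hab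
  have := le_csSup hSb hmem
  omega

variable [MeasurableSpace X] [BorelSpace X]

/-- At most `(D / r) ^ s` balls of diameter at most `6 * r * Δ` cover the space, and the total cost
`(6 * D * Δ) ^ s` does not depend on `r`. -/
theorem hausdorffMeasure_univ_ne_top (hX : IsQuasiSelfSimilar X D) (hD : 1 ≤ D)
    (hs : dimH (univ : Set X) = s) : μH[s] (univ : Set X) ≠ ∞ := by
  obtain ⟨Δ, hΔ0, hΔ⟩ : ∃ Δ : ℝ≥0, 0 < Δ ∧ ∀ x y : X, edist x y ≤ Δ := by
    refine ⟨(ediam (univ : Set X)).toNNReal + 1, by positivity, fun x y => ?_⟩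
    rw [ENNReal.coe_add, ENNReal.coe_toNNReal (Bornology.IsBounded.all _).ediam_ne_top]
    exact (edist_le_ediam_of_mem (mem_univ x) (mem_univ y)).trans le_self_add
  have hr0 : ∀ n : ℕ, 0 < ((n : ℝ≥0) + 1)⁻¹ := fun n => by positivity
  have hr1 : ∀ n : ℕ, ((n : ℝ≥0) + 1)⁻¹ ≤ 1 := fun n => inv_le_one_of_one_le₀ (by simp)
  choose T hTc hT using fun n : ℕ => hX.exists_finset_cover hD hs hΔ hΔ0 (hr0 n) (hr1 n)
  set r : ℕ → ℝ≥0 := fun n => ((n : ℝ≥0) + 1)⁻¹ with hr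
  have hdiam : ∀ n (x : X), ediam (closedEBall x (3 * (r n * Δ : ℝ≥0∞)))
      ≤ ((6 * (r n * Δ) : ℝ≥0) : ℝ≥0∞) := fun n x => by
    refine ediam_closedEBall_le.trans_eq ?_
    push_cast
    ring
  have hlim : Tendsto (fun n => ((6 * (r n * Δ) : ℝ≥0) : ℝ≥0∞)) atTop (𝓝 0) := by
    rw [← ENNReal.coe_zero, ENNReal.tendsto_coe]
    have h : Tendsto r atTop (𝓝 0) := by
      simpa [hr, one_div] using tendsto_one_div_add_atTop_nhds_zero_nat (𝕜 := ℝ≥0)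
    simpa using (h.mul_const Δ).const_mul 6
  have hle := Measure.hausdorffMeasure_le_liminf_sum (ι := fun n => T n) (s : ℝ) (univ : Set X)
    (l := atTop) _ hlim (fun n x => closedEBall (x : X) (3 * (r n * Δ : ℝ≥0∞)))
    (Eventually.of_forall fun n x => hdiam n x)
    (Eventually.of_forall fun n x _ => by
      obtain ⟨y, hy, hxy⟩ := hT n x
      exact mem_iUnion.2 ⟨⟨y, hy⟩, hxy⟩)
  refine (hle.trans (liminf_le_of_le (a := ((6 * (D * Δ) : ℝ≥0) : ℝ≥0∞) ^ (s : ℝ))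
    (h := fun b hb => ?_))).trans_lt
    (ENNReal.rpow_lt_top_of_nonneg s.coe_nonneg ENNReal.coe_ne_top) |>.ne
  obtain ⟨n, hn⟩ := hb.exists
  refine hn.trans ((Finset.sum_le_sum fun (x : T n) _ =>
    ENNReal.rpow_le_rpow (hdiam n x) s.coe_nonneg).trans ?_)
  rw [Finset.sum_const, nsmul_eq_mul, Finset.card_univ, Fintype.card_coe]
  refine (mul_le_mul_left (hTc n) _).trans_eq ?_
  rw [← ENNReal.mul_rpow_of_nonneg _ _ s.coe_nonneg, ← ENNReal.coe_mul]
  congr 2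
  have hn0 : r n ≠ 0 := (hr0 n).ne'
  change D / r n * (6 * (r n * Δ)) = _
  field_simp

end IsQuasiSelfSimilar

/-! ### Efficient copies and the density bound -/

/-- The `δ`-content of the Hausdorff measure, as an outer measure. -/
noncomputable abbrev deltaContent (X : Type*) [MetricSpace X] (s : ℝ) (δ : ℝ≥0∞) :
    OuterMeasure X :=
  OuterMeasure.mkMetric'.pre (fun A : Set X => ediam A ^ s) δ

theorem hausdorffMeasure_eq_iSup_deltaContent {X : Type*} [MetricSpace X] [MeasurableSpace X]
    [BorelSpace X] (s : ℝ) (A : Set X) :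
    μH[s] A = ⨆ (δ : ℝ≥0∞) (_ : 0 < δ), deltaContent X s δ A := by
  rw [Measure.hausdorffMeasure, ← OuterMeasure.coe_mkMetric, OuterMeasure.mkMetric,
    OuterMeasure.mkMetric']
  simp

/-- If every open set contains a closed set with efficient content that captures a definite
proportion of its content, then the content of all open sets is efficient. -/
theorem deltaContent_le_of_forall_exists {X : Type*} [MetricSpace X] [MeasurableSpace X]
    [BorelSpace X] {s : ℝ} {ε c : ℝ≥0} {δ : ℝ≥0∞} (hδ : 0 < δ)
    (hfin : μH[s] (univ : Set X) ≠ ∞)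
    (h : ∀ G : Set X, IsOpen G → ∃ A ⊆ G, IsClosed A ∧ deltaContent X s δ A ≤ ε * μH[s] A ∧
      deltaContent X s δ G ≤ c * μH[s] A) :
    deltaContent X s δ univ ≤ ε * μH[s] (univ : Set X) := by
  set H := deltaContent X s δ with hH
  have hfinA : ∀ A : Set X, μH[s] A ≠ ∞ := fun A =>
    ne_top_of_le_ne_top hfin (measure_mono (subset_univ A))
  have hHle : ∀ A : Set X, H A ≤ μH[s] A := fun A => by
    rw [hausdorffMeasure_eq_iSup_deltaContent]
    exact le_iSup₂_of_le δ hδ le_rfl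
  have hHfin : ∀ A : Set X, H A ≠ ∞ := fun A => ne_top_of_le_ne_top (hfinA A) (hHle A)
  -- The constants that work for all open sets; the least one, `κ`, is attained, and the aim is `κ ≤
  -- ε`.
  let S : Set ℝ≥0 := {k | ∀ G : Set X, IsOpen G → H G ≤ k * μH[s] G}
  have hS1 : (1 : ℝ≥0) ∈ S := fun G _ => by simpa using hHle G
  have hSc : IsClosed S := by
    simp only [S, ofPred_forall]
    refine isClosed_iInter fun G => isClosed_iInter fun _ => isClosed_le continuous_const ?_
    exact (ENNReal.continuous_mul_const (hfinA G)).comp ENNReal.continuous_coe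
  have hmem : sInf S ∈ S := hSc.csInf_mem ⟨1, hS1⟩ (OrderBot.bddBelow S)
  set κ := sInf S with hκ
  rcases le_or_gt κ ε with hle | hlt
  · exact (hmem univ isOpen_univ).trans (by gcongr)
  exfalso
  have hden : 0 < c + (κ - ε) := add_pos_of_nonneg_of_pos c.coe_nonneg (tsub_pos_of_lt hlt)
  -- Using `ε` on `A` and `κ` on the open set `G \ A` gives `H G ≤ κ * μH[s] G - (κ - ε) * μH[s] A`.
  -- Since `H G ≤ c * μH[s] A`, solving for `H G` gives this constant, which is smaller than `κ`.
  have hc : κ * c / (c + (κ - ε)) ∈ S := by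
    intro G hG
    obtain ⟨A, hAG, hAc, hA1, hA2⟩ := h G hG
    have h1 : H G ≤ ε * μH[s] A + κ * μH[s] (G \ A) := by
      calc H G ≤ H (A ∪ G \ A) := measure_mono (by rw [union_sdiff_cancel hAG])
        _ ≤ H A + H (G \ A) := measure_union_le _ _
        _ ≤ _ := add_le_add hA1 (hmem _ (hG.sdiff hAc))
    have h2 : μH[s] A + μH[s] (G \ A) = μH[s] G := by
      rw [measure_add_sdiff hAc.nullMeasurableSet, union_eq_self_of_subset_left hAG]
    lift H G to ℝ≥0 using hHfin G with hg
    lift μH[s] A to ℝ≥0 using hfinA A with a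
    lift μH[s] (G \ A) to ℝ≥0 using hfinA _ with b
    rw [← h2]
    norm_cast at h1 hA2 ⊢
    rw [div_mul_eq_mul_div, le_div_iff₀ hden]
    rw [← NNReal.coe_le_coe] at h1 hA2 ⊢
    push_cast [hlt.le] at h1 hA2 ⊢
    have h3 : (0 : ℝ) < κ - ε := sub_pos.2 hlt
    nlinarith [mul_le_mul_of_nonneg_left h1 c.coe_nonneg, mul_le_mul_of_nonneg_left hA2 h3.le]
  have hle : κ ≤ κ * c / (c + (κ - ε)) := csInf_le (OrderBot.bddBelow S) hc
  rw [le_div_iff₀ hden, mul_add] at hle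
  have hpos : 0 < κ * (κ - ε) := mul_pos (zero_le.trans_lt hlt) (tsub_pos_of_lt hlt)
  exact absurd hle (not_le.2 (lt_add_of_pos_right _ hpos))

namespace IsQuasiSelfSimilar

variable {X : Type*} [MetricSpace X] [CompactSpace X] {D Δ s ε : ℝ≥0}
  [MeasurableSpace X] [BorelSpace X]

/-- Each open set contains a disjoint union of small copies of a given set that captures a
definite proportion of its content. -/
theorem exists_isClosed_subset_deltaContent_le (hX : IsQuasiSelfSimilar X D)
    (hΔ : ∀ x y : X, edist x y ≤ Δ) (hΔ0 : 0 < Δ) (hD : 1 ≤ D) {V : Set X} (hV : IsClosed V)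
    (hε : (D * ediam V) ^ (s : ℝ) ≤ ε * μH[s] V) {δ : ℝ≥0∞} (hδ : 0 < δ)
    (hδ' : δ ≠ ∞) (hfin : μH[s] (univ : Set X) ≠ ∞) {G : Set X} (hG : IsOpen G) :
    ∃ A ⊆ G, IsClosed A ∧ deltaContent X s δ A ≤ ε * μH[s] A ∧
      deltaContent X s δ G * μH[s] V ≤ 2 * ((10 * Δ * D : ℝ≥0) : ℝ≥0∞) ^ (s : ℝ) * μH[s] A := by
  set H := deltaContent X s δ with hH
  lift δ to ℝ≥0 using hδ'
  have hδ0 : 0 < δ := by exact_mod_cast hδ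
  have hD0 : 0 < D := zero_lt_one.trans_le hD
  -- The factor `10` is for the five-fold Vitali enlargement of a ball of radius `r * Δ`, whose
  -- diameter must stay below `δ`.
  have hr : ∀ x ∈ G, ∃ r : ℝ≥0, 0 < r ∧ r ≤ 1 ∧ closedBall x (r * Δ) ⊆ G ∧ 10 * (r * Δ) ≤ δ := by
    intro x hx
    obtain ⟨e, he, hball⟩ := nhds_basis_closedBall.mem_iff.1 (hG.mem_nhds hx)
    lift e to ℝ≥0 using he.le
    have he' : 0 < e := by exact_mod_cast he
    refine ⟨min 1 (min (e / Δ) (δ / (10 * Δ))), by positivity, min_le_left _ _, ?_, ?_⟩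
    · refine (closedBall_subset_closedBall ?_).trans hball
      rw [← NNReal.coe_mul, NNReal.coe_le_coe, ← le_div_iff₀ hΔ0]
      exact (min_le_right _ _).trans (min_le_left _ _)
    · calc 10 * (min 1 (min (e / Δ) (δ / (10 * Δ))) * Δ) ≤ 10 * (δ / (10 * Δ) * Δ) := by
            gcongr
            exact (min_le_right _ _).trans (min_le_right _ _)
        _ = δ := by field_simp
  choose! r hr0 hr1 hrG hrδ using hr
  have hg : ∀ x ∈ G, ∃ g : X → X, x ∈ range g ∧ LipschitzWith (r x) g ∧
      AntilipschitzWith (D / r x) g := fun x hx => hX x (r x) (hr0 x hx) (hr1 x hx)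
  choose! g hgx hgL hgA using hg
  have hgball : ∀ x ∈ G, range (g x) ⊆ closedBall x (r x * Δ) := by
    rintro x hx _ ⟨a, rfl⟩
    obtain ⟨b, hb⟩ := hgx x hx
    rw [mem_closedBall, ← NNReal.coe_mul, dist_le_coe, ← ENNReal.coe_le_coe, ← edist_nndist,
      ENNReal.coe_mul]
    calc edist (g x a) x = edist (g x a) (g x b) := by rw [hb]
      _ ≤ r x * edist a b := hgL x hx a b
      _ ≤ r x * Δ := by gcongr; exact hΔ a b
  obtain ⟨u, huG, hudisj, hucov⟩ :=
    Vitali.exists_disjoint_subfamily_covering_enlargement_closedBall G id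
      (fun x => (r x * Δ : ℝ)) (δ : ℝ) (fun x hx => by
        have := hrδ x hx
        have h2 : r x * Δ ≤ 10 * (r x * Δ) := le_mul_of_one_le_left (by positivity) (by norm_num)
        exact_mod_cast h2.trans this) 5 (by norm_num)
  have hucount : u.Countable := by
    refine hudisj.countable_of_nonempty_interior fun x hx => ⟨x, ?_⟩
    refine ball_subset_interior_closedBall (mem_ball_self ?_)
    exact mul_pos (hr0 x (huG hx)) hΔ0
  have hcopy : ∀ x ∈ G, (((r x / D : ℝ≥0) : ℝ≥0∞)) ^ (s : ℝ) * μH[s] V ≤ μH[s] (g x '' V) := by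
    intro x hx
    have h := (hgA x hx).le_hausdorffMeasure_image s.coe_nonneg V
    calc _ ≤ ((r x / D : ℝ≥0) : ℝ≥0∞) ^ (s : ℝ) *
          (((D / r x : ℝ≥0) : ℝ≥0∞) ^ (s : ℝ) * μH[s] (g x '' V)) := by gcongr
      _ = _ := by
        rw [← mul_assoc, ← ENNReal.mul_rpow_of_nonneg _ _ s.coe_nonneg, ← ENNReal.coe_mul]
        have : r x / D * (D / r x) = 1 := by have := (hr0 x hx).ne'; field_simp
        simp [this]
  -- The copy is used as its own cover. Its diameter shrinks by at least `r x` and its measure by at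
  -- most `(r x / D) ^ s`; the factor `D` in the hypothesis on `V` absorbs the discrepancy.
  have hcopyH : ∀ x ∈ G, H (g x '' V) ≤ ε * μH[s] (g x '' V) := by
    intro x hx
    have hd : ediam (g x '' V) ≤ r x * ediam V := (hgL x hx).ediam_image_le V
    have hd' : ediam V ≤ Δ := ediam_le fun a _ b _ => hΔ a b
    refine (OuterMeasure.mkMetric'.pre_le ?_).trans ?_
    · refine hd.trans ((mul_le_mul_right hd' _).trans ?_)
      have h2 : r x * Δ ≤ 10 * (r x * Δ) := le_mul_of_one_le_left (by positivity) (by norm_num)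
      exact_mod_cast h2.trans (hrδ x hx)
    · calc ediam (g x '' V) ^ (s : ℝ) ≤ (r x * ediam V) ^ (s : ℝ) :=
          ENNReal.rpow_le_rpow hd s.coe_nonneg
        _ = ((r x / D : ℝ≥0) * (D * ediam V)) ^ (s : ℝ) := by
          rw [← mul_assoc, ← ENNReal.coe_mul, div_mul_cancel₀ _ hD0.ne']
        _ = ((r x / D : ℝ≥0) : ℝ≥0∞) ^ (s : ℝ) * (D * ediam V) ^ (s : ℝ) :=
          ENNReal.mul_rpow_of_nonneg _ _ s.coe_nonneg
        _ ≤ ((r x / D : ℝ≥0) : ℝ≥0∞) ^ (s : ℝ) * (ε * μH[s] V) := by gcongr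
        _ = ε * (((r x / D : ℝ≥0) : ℝ≥0∞) ^ (s : ℝ) * μH[s] V) := by ring
        _ ≤ _ := by gcongr; exact hcopy x hx
  have hclosed : ∀ x ∈ G, IsClosed (g x '' V) := fun x hx =>
    (hV.isCompact.image (hgL x hx).continuous).isClosed
  have hdisj : u.PairwiseDisjoint fun x => g x '' V := hudisj.mono_on fun x hx =>
    (image_subset_range _ _).trans (hgball x (huG hx))
  have hGtsum : H G ≤ ∑' x : u, ((10 * (r x * Δ) : ℝ≥0) : ℝ≥0∞) ^ (s : ℝ) := by
    have := hucount.to_subtype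
    have hsub : G ⊆ ⋃ x : u, closedBall (x : X) (5 * (r x * Δ)) := fun x hx => by
      obtain ⟨y, hy, hxy⟩ := hucov x hx
      exact mem_iUnion.2 ⟨⟨y, hy⟩, hxy (mem_closedBall_self (by positivity))⟩
    refine (measure_mono hsub).trans ((measure_iUnion_le _).trans (ENNReal.tsum_le_tsum fun x => ?_))
    have hd : ediam (closedBall (x : X) (5 * (r x * Δ))) ≤ ((10 * (r x * Δ) : ℝ≥0) : ℝ≥0∞) := by
      have h5 : (5 * (r x * Δ) : ℝ) = ((5 * (r x * Δ) : ℝ≥0) : ℝ) := by push_cast; ring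
      rw [h5, ← closedEBall_coe]
      refine ediam_closedEBall_le.trans_eq ?_
      push_cast
      ring
    refine (OuterMeasure.mkMetric'.pre_le (hd.trans ?_)).trans (ENNReal.rpow_le_rpow hd s.coe_nonneg)
    exact ENNReal.coe_le_coe.2 (hrδ x (huG x.2))
  set C : ℝ≥0∞ := ((10 * Δ * D : ℝ≥0) : ℝ≥0∞) ^ (s : ℝ) with hC
  have hsum : H G * μH[s] V ≤ ∑' x : u, C * μH[s] (g x '' V) := by
    rw [mul_comm]
    refine (mul_le_mul_right hGtsum _).trans ?_
    rw [← ENNReal.tsum_mul_left]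
    refine ENNReal.tsum_le_tsum fun x => ?_
    refine le_trans (le_of_eq ?_) (mul_le_mul_right (hcopy x (huG x.2)) C)
    have hx : ((10 * (r x * Δ) : ℝ≥0) : ℝ≥0∞) ^ (s : ℝ)
        = C * ((r x / D : ℝ≥0) : ℝ≥0∞) ^ (s : ℝ) := by
      rw [hC, ← ENNReal.mul_rpow_of_nonneg _ _ s.coe_nonneg, ← ENNReal.coe_mul]
      congr 2
      field_simp
    rw [hx]
    ring
  have hfinA : ∀ A : Set X, μH[s] A ≠ ∞ := fun A =>
    ne_top_of_le_ne_top hfin (measure_mono (subset_univ A))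
  have hHle : ∀ A : Set X, H A ≤ μH[s] A := fun A => by
    rw [hausdorffMeasure_eq_iSup_deltaContent]
    exact le_iSup₂_of_le (δ : ℝ≥0∞) hδ le_rfl
  rcases eq_or_ne (H G * μH[s] V) 0 with h0 | h0
  · exact ⟨∅, empty_subset _, isClosed_empty, by simp, by simp [h0]⟩
  -- Halving leaves room to keep only finitely many copies, so that their union is closed; this is
  -- the factor `2` in the conclusion.
  have hlt : H G * μH[s] V / 2 < ∑' x : u, C * μH[s] (g x '' V) :=
    (ENNReal.half_lt_self h0 (ENNReal.mul_ne_top (ne_top_of_le_ne_top (hfinA G) (hHle G))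
      (hfinA V))).trans_le hsum
  rw [ENNReal.tsum_eq_iSup_sum] at hlt
  obtain ⟨J, hJ⟩ := lt_iSup_iff.1 hlt
  have hJm : μH[s] (⋃ x ∈ J, g (x : X) '' V) = ∑ x ∈ J, μH[s] (g (x : X) '' V) :=
    measure_biUnion_finset (fun x _ y _ hxy => hdisj x.2 y.2 fun h => hxy (Subtype.ext h))
      fun x _ => (hclosed x (huG x.2)).measurableSet
  refine ⟨⋃ x ∈ J, g (x : X) '' V, ?_, ?_, ?_, ?_⟩
  · exact iUnion₂_subset fun x _ => (image_subset_range _ _).trans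
      ((hgball x (huG x.2)).trans (hrG x (huG x.2)))
  · exact J.finite_toSet.isClosed_biUnion fun x _ => hclosed x (huG x.2)
  · rw [hJm, Finset.mul_sum]
    exact (measure_biUnion_finset_le J _).trans
      (Finset.sum_le_sum fun x _ => hcopyH x (huG x.2))
  · rw [hJm, mul_assoc, Finset.mul_sum]
    exact ENNReal.div_le_iff_le_mul (by simp) (by simp) |>.1 hJ.le |>.trans_eq (mul_comm _ _)

/-- The Hausdorff measure of a set is comparable to the power of its diameter. -/
theorem hausdorffMeasure_le_mul_ediam_rpow [Nonempty X] (hX : IsQuasiSelfSimilar X D) (hD : 1 ≤ D)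
    (hs : dimH (univ : Set X) = s) (V : Set X) :
    μH[s] V ≤ (D : ℝ≥0∞) ^ (s : ℝ) * ediam V ^ (s : ℝ) := by
  -- Passing to the closure preserves the diameter and makes the copies of `V` compact.
  refine (measure_mono subset_closure).trans ?_
  rw [← ediam_closure, ← ENNReal.mul_rpow_of_nonneg _ _ s.coe_nonneg]
  have hV : IsClosed (closure V) := isClosed_closure
  generalize closure V = V at hV
  by_contra! hlt
  have hfin := hX.hausdorffMeasure_univ_ne_top hD hs
  have hfinV : μH[s] V ≠ ∞ := ne_top_of_le_ne_top hfin (measure_mono (subset_univ V))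
  have hV0 : μH[s] V ≠ 0 := (zero_le.trans_lt hlt).ne'
  obtain ⟨ε, hε1, hε⟩ : ∃ ε : ℝ≥0, ε < 1 ∧ (D * ediam V) ^ (s : ℝ) ≤ ε * μH[s] V := by
    have h1 : (D * ediam V) ^ (s : ℝ) / μH[s] V < 1 := by
      rw [ENNReal.div_lt_iff (Or.inl hV0) (Or.inl hfinV), one_mul]
      exact hlt
    refine ⟨((D * ediam V) ^ (s : ℝ) / μH[s] V).toNNReal, ?_, ?_⟩
    · rw [← ENNReal.coe_lt_coe, ENNReal.coe_toNNReal (ne_top_of_lt h1)]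
      exact h1
    · rw [ENNReal.coe_toNNReal (ne_top_of_lt h1), ENNReal.div_mul_cancel hV0 hfinV]
  obtain ⟨Δ, hΔ0, hΔ⟩ : ∃ Δ : ℝ≥0, 0 < Δ ∧ ∀ x y : X, edist x y ≤ Δ := by
    refine ⟨(ediam (univ : Set X)).toNNReal + 1, by positivity, fun x y => ?_⟩
    rw [ENNReal.coe_add, ENNReal.coe_toNNReal (Bornology.IsBounded.all _).ediam_ne_top]
    exact (edist_le_ediam_of_mem (mem_univ x) (mem_univ y)).trans le_self_add
  have hc : 2 * ((10 * Δ * D : ℝ≥0) : ℝ≥0∞) ^ (s : ℝ) / μH[s] V ≠ ∞ :=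
    ENNReal.div_ne_top (ENNReal.mul_ne_top (by simp)
      (ENNReal.rpow_ne_top_of_nonneg s.coe_nonneg ENNReal.coe_ne_top)) hV0
  have key : ∀ δ : ℝ≥0∞, 0 < δ → deltaContent X s δ univ ≤ ε * μH[s] (univ : Set X) := by
    intro δ hδ
    -- The Vitali argument needs a finite `δ`, and lowering `δ` only increases the content.
    have hδ1 : 0 < min δ 1 := lt_min hδ one_pos
    refine le_trans (OuterMeasure.mkMetric'.mono_pre _ (min_le_left δ 1) univ)
      (deltaContent_le_of_forall_exists hδ1 hfin
        (c := (2 * ((10 * Δ * D : ℝ≥0) : ℝ≥0∞) ^ (s : ℝ) / μH[s] V).toNNReal) fun G hG => ?_)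
    obtain ⟨A, hAG, hAc, hA1, hA2⟩ := hX.exists_isClosed_subset_deltaContent_le hΔ hΔ0 hD hV hε
      hδ1 (by simp) hfin hG
    refine ⟨A, hAG, hAc, hA1, ?_⟩
    rw [ENNReal.coe_toNNReal hc, ← ENNReal.mul_div_right_comm,
      ENNReal.le_div_iff_mul_le (Or.inl hV0) (Or.inl hfinV)]
    exact hA2
  have hle : μH[s] (univ : Set X) ≤ ε * μH[s] (univ : Set X) := by
    conv_lhs => rw [hausdorffMeasure_eq_iSup_deltaContent]
    exact iSup₂_le key
  have h0 : μH[s] (univ : Set X) ≠ 0 := fun h => hV0 (measure_mono_null (subset_univ V) h)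
  refine absurd hle (not_le.2 ?_)
  calc ε * μH[s] (univ : Set X) < 1 * μH[s] (univ : Set X) :=
        (ENNReal.mul_lt_mul_iff_left h0 hfin).2 (by exact_mod_cast hε1)
    _ = _ := one_mul _

end IsQuasiSelfSimilar

/-! ### Bounded distortion and quasi self-similarity -/

section Words

variable {X ι : Type*}

/-- The composition of the maps `f i` along a word. -/
def wordMap (f : ι → X → X) (w : List ι) : X → X :=
  w.foldr (fun i g => f i ∘ g) id

@[simp] theorem wordMap_nil (f : ι → X → X) (x : X) : wordMap f [] x = x := rfl

@[simp] theorem wordMap_cons (f : ι → X → X) (i : ι) (w : List ι) (x : X) :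
    wordMap f (i :: w) x = f i (wordMap f w x) := rfl

@[simp] theorem wordMap_concat (f : ι → X → X) (w : List ι) (i : ι) (x : X) :
    wordMap f (w ++ [i]) x = wordMap f w (f i x) := by
  induction w with
  | nil => rfl
  | cons j w ih => simp [ih]

variable [MetricSpace X] {f : ι → X → X} {l m C α Δ : ℝ}

theorem dist_wordMap_le (hl : 0 ≤ l) (hf : ∀ i x y, dist (f i x) (f i y) ≤ l * dist x y)
    (w : List ι) (x y : X) : dist (wordMap f w x) (wordMap f w y) ≤ l ^ w.length * dist x y := by
  induction w with
  | nil => simp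
  | cons i w ih =>
    rw [wordMap_cons, wordMap_cons, List.length_cons, pow_succ', mul_assoc]
    exact (hf _ _ _).trans (by gcongr)

theorem wordMap_injective (hm : 0 < m) (hf : ∀ i x y, m * dist x y ≤ dist (f i x) (f i y))
    (w : List ι) : Function.Injective (wordMap f w) := by
  induction w with
  | nil => exact fun _ _ => id
  | cons i w ih =>
    refine Function.Injective.comp (g := f i) (fun x y hxy => dist_le_zero.1 ?_) ih
    have := hf i x y
    rw [hxy, dist_self] at this
    exact nonpos_of_mul_nonpos_right this hm

/-- Bounded distortion along words. -/
theorem exists_dist_wordMap_mul_dist_le (hl : 0 ≤ l) (hl1 : l < 1) (hα : 0 < α) (hC : 0 ≤ C)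
    (hm : 0 < m) (hΔ : ∀ x y : X, dist x y ≤ Δ) (hΔ0 : 0 ≤ Δ)
    (hf : ∀ i x y, dist (f i x) (f i y) ≤ l * dist x y)
    (hfm : ∀ i x y, m * dist x y ≤ dist (f i x) (f i y))
    (hdist : ∀ i τ x y z t, dist x y ≤ τ → dist z t ≤ τ → dist x z ≤ τ →
      dist (f i x) (f i y) * dist z t ≤ Real.exp (C * τ ^ α) * (dist (f i z) (f i t) * dist x y)) :
    ∃ K : ℝ, 1 ≤ K ∧ ∀ w x y z t, dist (wordMap f w x) (wordMap f w y) * dist z t ≤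
      K * (dist (wordMap f w z) (wordMap f w t) * dist x y) := by
  set θ := l ^ α with hθ
  have hθ0 : 0 ≤ θ := Real.rpow_nonneg hl _
  have hθ1 : θ < 1 := Real.rpow_lt_one hl hl1 hα
  set B := C * Δ ^ α / (1 - θ) with hB
  have hB0 : 0 ≤ B := div_nonneg (mul_nonneg hC (Real.rpow_nonneg hΔ0 _)) (sub_pos.2 hθ1).le
  -- The images under a word of length `n` have diameter at most `l ^ n * Δ`, so the next outer map
  -- adds `C * Δ ^ α * θ ^ n` to the exponent; the partial sums of this geometric series are `B * (1
  -- - θ ^ n)`.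
  have key : ∀ (w : List ι) (x y z t : X), dist (wordMap f w x) (wordMap f w y) * dist z t ≤
      Real.exp (B * (1 - θ ^ w.length)) *
        (dist (wordMap f w z) (wordMap f w t) * dist x y) := by
    intro w x y z t
    induction w with
    | nil => simp [mul_comm]
    | cons i w ih =>
      rcases eq_or_ne x y with rfl | hxy
      · simp
      rcases eq_or_ne z t with rfl | hzt
      · simp
      have hinj := wordMap_injective hm hfm w
      set x' := wordMap f w x
      set y' := wordMap f w y
      set z' := wordMap f w z
      set t' := wordMap f w t
      have hτ : ∀ a b, dist (wordMap f w a) (wordMap f w b) ≤ l ^ w.length * Δ := fun a b =>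
        (dist_wordMap_le hl hf w a b).trans (by gcongr; exact hΔ a b)
      have h1 := hdist i _ x' y' z' t' (hτ x y) (hτ z t) (hτ x z)
      have hpow : (l ^ w.length * Δ) ^ α = θ ^ w.length * Δ ^ α := by
        rw [Real.mul_rpow (pow_nonneg hl _) hΔ0, hθ, ← Real.rpow_natCast, ← Real.rpow_natCast,
          ← Real.rpow_mul hl, ← Real.rpow_mul hl, mul_comm (α)]
      have hexp : Real.exp (B * (1 - θ ^ (i :: w).length))
          = Real.exp (C * (l ^ w.length * Δ) ^ α) * Real.exp (B * (1 - θ ^ w.length)) := by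
        rw [← Real.exp_add, hpow, List.length_cons, pow_succ]
        congr 1
        have : C * Δ ^ α = B * (1 - θ) := by rw [hB, div_mul_cancel₀ _ (sub_pos.2 hθ1).ne']
        linear_combination -θ ^ w.length * this
      rw [hexp, wordMap_cons, wordMap_cons, wordMap_cons, wordMap_cons]
      -- The two distortion inequalities are multiplied and this common factor, positive by
      -- injectivity, is cancelled.
      have hpos : 0 < dist x' y' * dist z' t' :=
        mul_pos (dist_pos.2 (hinj.ne hxy)) (dist_pos.2 (hinj.ne hzt))
      refine le_of_mul_le_mul_right ?_ hpos
      have := mul_le_mul h1 ih (by positivity) (by positivity)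
      calc _ = dist (f i x') (f i y') * dist z' t' * (dist x' y' * dist z t) := by ring
        _ ≤ _ := this
        _ = _ := by ring
  refine ⟨Real.exp B, Real.one_le_exp hB0, fun w x y z t => (key w x y z t).trans ?_⟩
  gcongr
  exact mul_le_of_le_one_right hB0 (sub_le_self _ (pow_nonneg hθ0 _))

/-- A word acts as a similarity of ratio `R w` up to the factor `K`. Extending the word on the right
follows the coding of `x`; each letter lowers the ratio by a bounded factor only, so the ratio
cannot jump far past the target `r`. -/
theorem exists_isQuasiSelfSimilar_of_distortion [BoundedSpace X] (hl : 0 ≤ l) (hl1 : l < 1)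
    (hα : 0 < α) (hC : 0 ≤ C) (hm : 0 < m)
    (hf : ∀ i x y, dist (f i x) (f i y) ≤ l * dist x y)
    (hfm : ∀ i x y, m * dist x y ≤ dist (f i x) (f i y))
    (hdist : ∀ i τ x y z t, dist x y ≤ τ → dist z t ≤ τ → dist x z ≤ τ →
      dist (f i x) (f i y) * dist z t ≤ Real.exp (C * τ ^ α) * (dist (f i z) (f i t) * dist x y))
    (hcov : ∀ x, ∃ i y, f i y = x) : ∃ D : ℝ≥0, 1 ≤ D ∧ IsQuasiSelfSimilar X D := by
  rcases subsingleton_or_nontrivial X with hX | hX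
  · refine ⟨1, le_rfl, fun x r _ _ => ⟨id, ⟨x, rfl⟩, fun a b => ?_, fun a b => ?_⟩⟩ <;>
      simp [Subsingleton.elim a b]
  obtain ⟨a, b, hab⟩ := exists_pair_ne X
  have hab0 : 0 < dist a b := dist_pos.2 hab
  obtain ⟨K, hK1, hK⟩ := exists_dist_wordMap_mul_dist_le hl hl1 hα hC hm
    (fun x y => dist_le_diam_of_mem (Bornology.IsBounded.all univ) (mem_univ x) (mem_univ y))
    diam_nonneg hf hfm hdist
  have hK0 : 0 < K := one_pos.trans_le hK1
  let R : List ι → ℝ := fun w => dist (wordMap f w a) (wordMap f w b) / dist a b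
  have hup : ∀ w x y, dist (wordMap f w x) (wordMap f w y) ≤ K * R w * dist x y := fun w x y => by
    rw [mul_assoc, div_mul_eq_mul_div, mul_div_assoc', le_div_iff₀ hab0]
    exact hK w x y a b
  have hlow : ∀ w x y, R w * dist x y ≤ K * dist (wordMap f w x) (wordMap f w y) := fun w x y => by
    rw [div_mul_eq_mul_div, div_le_iff₀ hab0, mul_assoc]
    exact hK w a b x y
  have hRsucc : ∀ w i, m * R w ≤ K * R (w ++ [i]) := fun w i => by
    simp only [R, wordMap_concat]
    rw [mul_div_assoc', mul_div_assoc']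
    refine (div_le_div_iff_of_pos_right hab0).2 ?_
    have h1 := hlow w (f i a) (f i b)
    calc _ = R w * (m * dist a b) := by simp only [R]; field_simp
      _ ≤ R w * dist (f i a) (f i b) := by gcongr; exact hfm i a b
      _ ≤ _ := h1
  have hm1 : m ≤ 1 := by
    obtain ⟨i, -⟩ := hcov a
    have := (hfm i a b).trans (hf i a b)
    exact (le_of_mul_le_mul_right this hab0).trans hl1.le
  -- `K ^ 2 / m` is the loss at the stopping word, and one more `K` comes from comparing `R w` with
  -- actual distances.
  obtain ⟨D, hD⟩ : ∃ D : ℝ≥0, (D : ℝ) = K ^ 3 / m := ⟨_, Real.coe_toNNReal _ (by positivity)⟩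
  refine ⟨D, ?_, fun x r hr0 hr1 => ?_⟩
  · rw [← NNReal.coe_le_coe, hD]
    exact (one_le_div hm).2 (hm1.trans (one_le_pow₀ hK1))
  have hr0' : (0 : ℝ) < r := hr0
  have hr1' : (r : ℝ) ≤ 1 := hr1
  suffices h : ∃ w, x ∈ range (wordMap f w) ∧ K * R w ≤ r ∧ r * m ≤ K ^ 2 * R w by
    obtain ⟨w, hxw, h1, h2⟩ := h
    refine ⟨wordMap f w, hxw, LipschitzWith.of_dist_le_mul fun y z => (hup w y z).trans (by gcongr),
      AntilipschitzWith.of_le_mul_dist fun y z => ?_⟩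
    rw [NNReal.coe_div, hD, div_div, div_mul_eq_mul_div, le_div_iff₀ (by positivity)]
    calc dist y z * (m * r) = r * m * dist y z := by ring
      _ ≤ K ^ 2 * R w * dist y z := by gcongr
      _ = K ^ 2 * (R w * dist y z) := by ring
      _ ≤ K ^ 2 * (K * dist (wordMap f w y) (wordMap f w z)) :=
        mul_le_mul_of_nonneg_left (hlow w y z) (by positivity)
      _ = _ := by ring
  -- If no word stops, the bound `r < K * R w` passes from each word to an extension that still
  -- codes `x`, hence holds for arbitrarily long words, whereas `R w ≤ l ^ w.length` tends to zero.
  by_contra! hno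
  have hR0 : R [] = 1 := by simp [R, hab0.ne']
  have hlong : ∀ n : ℕ, ∃ w : List ι, w.length = n ∧ x ∈ range (wordMap f w) ∧ r < K * R w := by
    intro n
    induction n with
    | zero =>
      refine ⟨[], rfl, ⟨x, rfl⟩, ?_⟩
      by_contra! hle
      refine absurd (hno [] ⟨x, rfl⟩ hle) (not_lt.2 ?_)
      rw [hR0, mul_one]
      exact (mul_le_one₀ hr1' hm.le hm1).trans (one_le_pow₀ hK1)
    | succ n ih =>
      obtain ⟨w, hw, ⟨y, rfl⟩, hr⟩ := ih
      obtain ⟨i, z, rfl⟩ := hcov y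
      have hmem : wordMap f w (f i z) ∈ range (wordMap f (w ++ [i])) := ⟨z, by simp⟩
      refine ⟨w ++ [i], by simp [hw], hmem, ?_⟩
      by_contra! hle
      refine absurd (hno _ hmem hle) (not_lt.2 ?_)
      calc r * m ≤ K * R w * m := by gcongr
        _ = K * (m * R w) := by ring
        _ ≤ K * (K * R (w ++ [i])) := mul_le_mul_of_nonneg_left (hRsucc w i) hK0.le
        _ = _ := by ring
  obtain ⟨n, hn⟩ := exists_pow_lt_of_lt_one (div_pos hr0' hK0) hl1
  obtain ⟨w, rfl, -, hw⟩ := hlong n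
  refine absurd hw (not_lt.2 ?_)
  have : R w ≤ l ^ w.length := by
    rw [div_le_iff₀ hab0]
    exact dist_wordMap_le hl hf w a b
  calc K * R w ≤ K * (r / K) := by gcongr; exact this.trans hn.le
    _ = r := by field_simp

end Words

/-! ### Metric estimates for conformal maps -/

section Conformal

variable {d : ℕ} {F Ω : Set (EuclideanSpace ℝ (Fin d))}
  {f : EuclideanSpace ℝ (Fin d) → EuclideanSpace ℝ (Fin d)} {α c : ℝ}

theorem IsConformalOn.norm_fderiv_apply (hf : IsConformalOn f Ω) {x : EuclideanSpace ℝ (Fin d)}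
    (hx : x ∈ Ω) (y : EuclideanSpace ℝ (Fin d)) :
    ‖fderiv ℝ f x y‖ = ‖fderiv ℝ f x‖ * ‖y‖ := by
  rcases eq_or_ne y 0 with rfl | hy
  · simp
  · exact (hf.similarity x hx y hy).1

theorem IsConformalOn.norm_fderiv_pos [Nontrivial (EuclideanSpace ℝ (Fin d))]
    (hf : IsConformalOn f Ω) {x : EuclideanSpace ℝ (Fin d)} (hx : x ∈ Ω) :
    0 < ‖fderiv ℝ f x‖ := by
  obtain ⟨y, hy⟩ := exists_ne (0 : EuclideanSpace ℝ (Fin d))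
  obtain ⟨h1, h2⟩ := hf.similarity x hx y hy
  refine norm_pos_iff.2 fun h => h2 ?_
  simp [h]

/-- The mean value inequality on the segment, applied to `f` minus its differential at `x`; that
differential scales all lengths equally. -/
theorem IsConformalOn.abs_dist_sub_le (hf : IsConformalOn f Ω) (hΩ : IsOpen Ω)
    (hconv : Convex ℝ Ω) (hα : 0 < α) (hc : 0 ≤ c)
    (hhol : ∀ x ∈ Ω, ∀ y ∈ Ω, ‖fderiv ℝ f x - fderiv ℝ f y‖ ≤ c * ‖x - y‖ ^ α)
    {x y : EuclideanSpace ℝ (Fin d)} (hx : x ∈ Ω) (hy : y ∈ Ω) :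
    |dist (f x) (f y) - ‖fderiv ℝ f x‖ * dist x y| ≤ c * dist x y ^ α * dist x y := by
  have hseg : segment ℝ x y ⊆ Ω := hconv.segment_subset hx hy
  have h := (convex_segment x y).norm_image_sub_le_of_norm_hasFDerivWithin_le'
    (f := f) (f' := fderiv ℝ f) (φ := fderiv ℝ f x) (C := c * dist x y ^ α)
    (fun z hz => ((hf.contDiffOn.differentiableOn one_ne_zero).differentiableAt
      (hΩ.mem_nhds (hseg hz))).hasFDerivAt.hasFDerivWithinAt)
    (fun z hz => (hhol z (hseg hz) x hx).trans ?_)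
    (left_mem_segment ℝ x y) (right_mem_segment ℝ x y)
  · rw [dist_comm x y, dist_comm (f x), dist_eq_norm y x, dist_eq_norm (f y),
      ← hf.norm_fderiv_apply hx]
    refine (abs_norm_sub_norm_le _ _).trans (h.trans_eq ?_)
    rw [dist_comm, dist_eq_norm]
  · have hzx : ‖z - x‖ ≤ dist x y := by
      rw [← dist_eq_norm, dist_comm, ← dist_add_dist_of_mem_segment hz]
      exact le_add_of_nonneg_right dist_nonneg
    gcongr

theorem IsConformalOn.continuousOn_norm_fderiv (hf : IsConformalOn f Ω) (hΩ : IsOpen Ω) :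
    ContinuousOn (fun x => ‖fderiv ℝ f x‖) Ω :=
  (hf.contDiffOn.continuousOn_fderiv_of_isOpen hΩ le_rfl).norm

/-- For close points the differential dominates, and its norm is bounded below on the compact `F`.
For points at distance at least `η`, injectivity and compactness keep the images apart. -/
theorem IsConformalOn.exists_mul_dist_le (hf : IsConformalOn f Ω) (hΩ : IsOpen Ω)
    (hconv : Convex ℝ Ω) (hinj : InjOn f Ω) (hα : 0 < α) (hc : 0 ≤ c)
    (hhol : ∀ x ∈ Ω, ∀ y ∈ Ω, ‖fderiv ℝ f x - fderiv ℝ f y‖ ≤ c * ‖x - y‖ ^ α)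
    (hF : IsCompact F) (hFΩ : F ⊆ Ω) :
    ∃ m : ℝ, 0 < m ∧ ∀ x ∈ F, ∀ y ∈ F, m * dist x y ≤ dist (f x) (f y) := by
  rcases subsingleton_or_nontrivial (EuclideanSpace ℝ (Fin d)) with hE | hE
  · exact ⟨1, one_pos, fun x _ y _ => by simp [Subsingleton.elim x y]⟩
  obtain ⟨a, ha0, ha⟩ := hF.exists_forall_le' ((hf.continuousOn_norm_fderiv hΩ).mono hFΩ)
    (fun x hx => hf.norm_fderiv_pos (hFΩ hx))
  obtain ⟨η, hη0, hη⟩ : ∃ η : ℝ, 0 < η ∧ ∀ t, 0 ≤ t → t < η → c * t ^ α ≤ a / 2 := by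
    have hlim : Tendsto (fun t : ℝ => c * t ^ α) (𝓝 0) (𝓝 (c * 0 ^ α)) :=
      ((Real.continuous_rpow_const hα.le).const_mul c).tendsto 0
    rw [Real.zero_rpow hα.ne', mul_zero] at hlim
    obtain ⟨η, hη0, hη⟩ := Metric.eventually_nhds_iff.1 (hlim.eventually_lt_const (half_pos ha0))
    refine ⟨η, hη0, fun t ht htη => (hη ?_).le⟩
    rwa [Real.dist_eq, sub_zero, abs_of_nonneg ht]
  have hcont : ContinuousOn f F := hf.contDiffOn.continuousOn.mono hFΩ
  set K : Set (EuclideanSpace ℝ (Fin d) × EuclideanSpace ℝ (Fin d)) :=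
    (F ×ˢ F) ∩ {p | η ≤ dist p.1 p.2} with hKdef
  have hK : IsCompact K := (hF.prod hF).inter_right (isClosed_le continuous_const continuous_dist)
  have h₁ : ContinuousOn (fun p => f p.1) K :=
    hcont.comp (f := Prod.fst) continuousOn_fst fun p hp => hp.1.1
  have h₂ : ContinuousOn (fun p => f p.2) K :=
    hcont.comp (f := Prod.snd) continuousOn_snd fun p hp => hp.1.2
  have h₁₂ : ContinuousOn (fun p => dist (f p.1) (f p.2)) K :=
    continuous_dist.comp_continuousOn (h₁.prodMk h₂)
  obtain ⟨b, hb0, hb⟩ := hK.exists_forall_le' (a := 0) h₁₂ (fun p hp => by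
        refine dist_pos.2 fun h => ?_
        have h0 := hinj (hFΩ hp.1.1) (hFΩ hp.1.2) h
        have h1 : η ≤ dist p.1 p.2 := hp.2
        rw [h0, dist_self] at h1
        exact hη0.not_ge h1)
  have hΔ0 : 0 < diam F + 1 := add_pos_of_nonneg_of_pos diam_nonneg one_pos
  refine ⟨min (a / 2) (b / (diam F + 1)), lt_min (half_pos ha0) (div_pos hb0 hΔ0),
    fun x hx y hy => ?_⟩
  rcases lt_or_ge (dist x y) η with h | h
  · have h1 := (abs_le.1 (hf.abs_dist_sub_le hΩ hconv hα hc hhol (hFΩ hx) (hFΩ hy))).1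
    have h2 : a * dist x y ≤ ‖fderiv ℝ f x‖ * dist x y := by gcongr; exact ha x hx
    have h3 : c * dist x y ^ α * dist x y ≤ a / 2 * dist x y := by
      gcongr; exact hη _ dist_nonneg h
    calc _ ≤ a / 2 * dist x y := by gcongr; exact min_le_left _ _
      _ ≤ _ := by linarith
  · calc _ ≤ b / (diam F + 1) * (diam F + 1) := by
          gcongr
          · exact min_le_right _ _
          · exact (dist_le_diam_of_mem hF.isBounded hx hy).trans (le_add_of_nonneg_right one_pos.le)
      _ = b := div_mul_cancel₀ _ hΔ0.ne'
      _ ≤ _ := hb (x, y) ⟨⟨hx, hy⟩, h⟩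

/-- Three errors of size `ρ = c * τ ^ α` arise: linearising at `x`, linearising at `z`, and changing
the base point. The lower bound `m` turns these additive errors into a relative one. -/
theorem IsConformalOn.dist_mul_dist_le_exp (hf : IsConformalOn f Ω) (hΩ : IsOpen Ω)
    (hconv : Convex ℝ Ω) (hα : 0 < α) (hc : 0 ≤ c)
    (hhol : ∀ x ∈ Ω, ∀ y ∈ Ω, ‖fderiv ℝ f x - fderiv ℝ f y‖ ≤ c * ‖x - y‖ ^ α)
    (hFΩ : F ⊆ Ω) {m : ℝ} (hm : 0 < m)
    (hfm : ∀ x ∈ F, ∀ y ∈ F, m * dist x y ≤ dist (f x) (f y)) {τ : ℝ}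
    {x y z t : EuclideanSpace ℝ (Fin d)} (hx : x ∈ F) (hy : y ∈ F) (hz : z ∈ F) (ht : t ∈ F)
    (hxy : dist x y ≤ τ) (hzt : dist z t ≤ τ) (hxz : dist x z ≤ τ) :
    dist (f x) (f y) * dist z t ≤
      Real.exp (3 * c / m * τ ^ α) * (dist (f z) (f t) * dist x y) := by
  have hτ0 : 0 ≤ τ := dist_nonneg.trans hxy
  set ρ := c * τ ^ α with hρ
  have hρ0 : 0 ≤ ρ := mul_nonneg hc (Real.rpow_nonneg hτ0 _)
  have hpow : ∀ {u}, 0 ≤ u → u ≤ τ → c * u ^ α ≤ ρ := fun h0 h => by rw [hρ]; gcongr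
  have h1 : dist (f x) (f y) ≤ (‖fderiv ℝ f x‖ + ρ) * dist x y := by
    have := (abs_le.1 (hf.abs_dist_sub_le hΩ hconv hα hc hhol (hFΩ hx) (hFΩ hy))).2
    have h := mul_le_mul_of_nonneg_right (hpow dist_nonneg hxy) (dist_nonneg (x := x) (y := y))
    linarith
  have h2 : (‖fderiv ℝ f z‖ - ρ) * dist z t ≤ dist (f z) (f t) := by
    have := (abs_le.1 (hf.abs_dist_sub_le hΩ hconv hα hc hhol (hFΩ hz) (hFΩ ht))).1
    have h := mul_le_mul_of_nonneg_right (hpow dist_nonneg hzt) (dist_nonneg (x := z) (y := t))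
    linarith
  have h3 : ‖fderiv ℝ f x‖ ≤ ‖fderiv ℝ f z‖ + ρ := by
    have := (norm_sub_norm_le _ _).trans (hhol x (hFΩ hx) z (hFΩ hz))
    rw [← dist_eq_norm] at this
    linarith [hpow dist_nonneg hxz]
  have h4 : dist z t ≤ dist (f z) (f t) / m := by
    rw [le_div_iff₀ hm, mul_comm]
    exact hfm z hz t ht
  calc dist (f x) (f y) * dist z t ≤ ((‖fderiv ℝ f z‖ + ρ + ρ) * dist x y) * dist z t := by
        gcongr
        exact h1.trans (by gcongr)
    _ = ((‖fderiv ℝ f z‖ - ρ) * dist z t + 3 * ρ * dist z t) * dist x y := by ring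
    _ ≤ (dist (f z) (f t) + 3 * ρ * (dist (f z) (f t) / m)) * dist x y := by gcongr
    _ = (3 * c / m * τ ^ α + 1) * (dist (f z) (f t) * dist x y) := by rw [hρ]; ring
    _ ≤ _ := by gcongr; exact Real.add_one_le_exp _

variable {N : ℕ} {φ : Fin N → EuclideanSpace ℝ (Fin d) → EuclideanSpace ℝ (Fin d)}

/-- The smallest exponent serves all the maps, since `Ω` is bounded and the surplus powers are
absorbed in the constant. -/
theorem IsConformalIFS.exists_uniform_holder (h : IsConformalIFS Ω φ) :
    ∃ α c : ℝ, 0 < α ∧ 0 ≤ c ∧ ∀ i, ∀ x ∈ Ω, ∀ y ∈ Ω,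
      ‖fderiv ℝ (φ i) x - fderiv ℝ (φ i) y‖ ≤ c * ‖x - y‖ ^ α := by
  have : Nonempty (Fin N) := ⟨⟨0, by have := h.two_le; omega⟩⟩
  choose α c hα hc hhol using fun i => (h.conformal i).holder
  obtain ⟨i₀, hi₀⟩ := Finite.exists_min α
  have hterm : ∀ i, 0 ≤ c i * (diam Ω) ^ (α i - α i₀) := fun i =>
    mul_nonneg (hc i).le (Real.rpow_nonneg diam_nonneg _)
  refine ⟨α i₀, ∑ i, c i * (diam Ω) ^ (α i - α i₀), hα i₀, Finset.sum_nonneg fun i _ => hterm i,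
    fun i x hx y hy => (hhol i x hx y hy).trans ?_⟩
  rcases eq_or_ne x y with rfl | hxy
  · simp [(hα _).ne']
  have hpos : 0 < ‖x - y‖ := norm_pos_iff.2 (sub_ne_zero.2 hxy)
  have hle : ‖x - y‖ ≤ diam Ω := dist_eq_norm x y ▸ dist_le_diam_of_mem h.bounded hx hy
  calc c i * ‖x - y‖ ^ α i = c i * ‖x - y‖ ^ (α i - α i₀) * ‖x - y‖ ^ α i₀ := by
        rw [mul_assoc, ← Real.rpow_add hpos, sub_add_cancel]
    _ ≤ c i * (diam Ω) ^ (α i - α i₀) * ‖x - y‖ ^ α i₀ := by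
        have := (hc i).le
        gcongr
        exact sub_nonneg.2 (hi₀ i)
    _ ≤ _ := by
        gcongr
        exact Finset.single_le_sum (f := fun i => c i * (diam Ω) ^ (α i - α i₀))
          (fun i _ => hterm i) (Finset.mem_univ i)

theorem IsConformalIFS.exists_uniform_contraction (h : IsConformalIFS Ω φ) :
    ∃ l : ℝ, 0 ≤ l ∧ l < 1 ∧ ∀ i, ∀ x ∈ Ω, ∀ y ∈ Ω, dist (φ i x) (φ i y) ≤ l * dist x y := by
  have : Nonempty (Fin N) := ⟨⟨0, by have := h.two_le; omega⟩⟩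
  obtain ⟨i₀, hi₀⟩ := Finite.exists_max fun i => ⨆ x ∈ Ω, ‖fderiv ℝ (φ i) x‖ₑ
  have hlt := h.contracting i₀
  refine ⟨(⨆ x ∈ Ω, ‖fderiv ℝ (φ i₀) x‖ₑ).toReal, ENNReal.toReal_nonneg, ?_,
    fun i x hx y hy => ?_⟩
  · simpa using (ENNReal.toReal_lt_toReal hlt.ne_top ENNReal.one_ne_top).2 hlt
  rw [dist_eq_norm, dist_eq_norm]
  refine h.convex.norm_image_sub_le_of_norm_hasFDerivWithin_le (f' := fderiv ℝ (φ i))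
    (fun z hz => (((h.conformal i).contDiffOn.differentiableOn one_ne_zero).differentiableAt
      (h.isOpen.mem_nhds hz)).hasFDerivAt.hasFDerivWithinAt) (fun z hz => ?_) hy hx
  rw [← toReal_enorm]
  exact ENNReal.toReal_mono hlt.ne_top
    ((le_iSup₂ (f := fun x (_ : x ∈ Ω) => ‖fderiv ℝ (φ i) x‖ₑ) z hz).trans (hi₀ i))

theorem IsSelfConformal.exists_isQuasiSelfSimilar (hF : IsSelfConformal F) :
    ∃ D : ℝ≥0, 1 ≤ D ∧ IsQuasiSelfSimilar F D := by
  obtain ⟨N, Ω, φ, h, -, hFc, hFΩ, hFeq⟩ := hF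
  have : Nonempty (Fin N) := ⟨⟨0, by have := h.two_le; omega⟩⟩
  have : CompactSpace F := isCompact_iff_compactSpace.1 hFc
  obtain ⟨α, c, hα, hc, hhol⟩ := h.exists_uniform_holder
  obtain ⟨l, hl0, hl1, hl⟩ := h.exists_uniform_contraction
  choose m hm hfm using fun i => (h.conformal i).exists_mul_dist_le h.isOpen h.convex (h.injOn i)
    hα hc (hhol i) hFc hFΩ
  obtain ⟨i₀, hi₀⟩ := Finite.exists_min m
  have hfm' : ∀ i, ∀ x ∈ F, ∀ y ∈ F, m i₀ * dist x y ≤ dist (φ i x) (φ i y) :=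
    fun i x hx y hy => (mul_le_mul_of_nonneg_right (hi₀ i) dist_nonneg).trans (hfm i x hx y hy)
  have hmaps : ∀ i (x : F), φ i x ∈ F := fun i x =>
    hFeq.symm.subset (mem_iUnion.2 ⟨i, x, x.2, rfl⟩)
  refine exists_isQuasiSelfSimilar_of_distortion (f := fun i (x : F) => (⟨φ i x, hmaps i x⟩ : F))
    hl0 hl1 hα (C := 3 * c / m i₀) (div_nonneg (by positivity) (hm i₀).le) (hm i₀)
    (fun i x y => hl i x (hFΩ x.2) y (hFΩ y.2)) (fun i x y => hfm' i x x.2 y y.2)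
    (fun i τ x y z t hxy hzt hxz => (h.conformal i).dist_mul_dist_le_exp h.isOpen h.convex hα hc
      (hhol i) hFΩ (hm i₀) (hfm' i) x.2 y.2 z.2 t.2 hxy hzt hxz) fun x => ?_
  obtain ⟨i, y, hy, hyx⟩ := mem_iUnion.1 (hFeq.subset x.2)
  exact ⟨i, ⟨y, hy⟩, Subtype.ext hyx⟩

end Conformal

/-! ### Passage to subsets of the ambient space; Ahlfors regularity -/

/-- The Hausdorff measure of a quasi self-similar space is bounded below on balls. -/
theorem IsQuasiSelfSimilar.hausdorffMeasure_univ_le_mul_closedBall {X : Type*} [MetricSpace X]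
    [MeasurableSpace X] [BorelSpace X] {D Δ : ℝ≥0} (hX : IsQuasiSelfSimilar X D)
    (hΔ : ∀ x y : X, edist x y ≤ Δ) {s : ℝ} (hs : 0 ≤ s) (x : X) {r : ℝ≥0} (hr0 : 0 < r)
    (hr1 : r ≤ 1) :
    μH[s] (univ : Set X) ≤
      ((D / r : ℝ≥0) : ℝ≥0∞) ^ s * μH[s] (closedBall x (r * Δ)) := by
  obtain ⟨g, ⟨b, rfl⟩, hgL, hgA⟩ := hX x r hr0 hr1
  refine (hgA.le_hausdorffMeasure_image hs univ).trans ?_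
  gcongr
  rintro _ ⟨a, -, rfl⟩
  rw [mem_closedBall, ← NNReal.coe_mul, dist_le_coe, ← ENNReal.coe_le_coe, ← edist_nndist,
    ENNReal.coe_mul]
  exact (hgL a b).trans (by gcongr; exact hΔ a b)

theorem hausdorffMeasure_coe_preimage {E : Type*} [MetricSpace E] [MeasurableSpace E]
    [BorelSpace E] (F V : Set E) {s : ℝ} (hs : 0 ≤ s) :
    μH[s] ((↑) ⁻¹' V : Set F) = μH[s] (F ∩ V) := by
  rw [← isometry_subtype_coe.hausdorffMeasure_image (Or.inl hs), Subtype.image_preimage_coe]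

theorem ediam_coe_preimage {E : Type*} [MetricSpace E] (F V : Set E) :
    ediam ((↑) ⁻¹' V : Set F) = ediam (F ∩ V) := by
  rw [← isometry_subtype_coe.ediam_image, Subtype.image_preimage_coe]

/-- The mass distribution argument: sum the hypothesis over an arbitrary cover. -/
theorem le_mul_hausdorffContent {X : Type*} [MetricSpace X] [MeasurableSpace X] {μ : Measure X}
    {s : ℝ} {C : ℝ≥0∞} (hC0 : C ≠ 0) (hC : C ≠ ∞) {B : Set X}
    (h : ∀ V : Set X, μ (B ∩ V) ≤ C * ediam V ^ s) : μ B ≤ C * hausdorffContent s B := by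
  rw [← ENNReal.inv_mul_le_iff hC0 hC]
  refine le_iInf fun U => le_iInf fun hU => le_iInf fun _ => ?_
  rw [ENNReal.inv_mul_le_iff hC0 hC, ← ENNReal.tsum_mul_left]
  calc μ B ≤ μ (⋃ n, B ∩ U n) := measure_mono (by rw [← inter_iUnion, inter_eq_left.2 hU])
    _ ≤ ∑' n, μ (B ∩ U n) := measure_iUnion_le _
    _ ≤ _ := ENNReal.tsum_le_tsum fun n => by
      rcases (U n).eq_empty_or_nonempty with hn | hn
      · simp [hn]
      · simpa [hn] using h (U n)

section AhlforsRegular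

variable {d : ℕ} {F : Set (EuclideanSpace ℝ (Fin d))} {s : ℝ}

/-- The mass distribution principle for Ahlfors regular sets. -/
theorem IsAhlforsRegular.hausdorffMeasure_pos (hs : 0 ≤ s) (hF : IsAhlforsRegular s F)
    (hFb : Bornology.IsBounded F) (hFn : F.Nontrivial) : 0 < μH[s] F := by
  obtain ⟨μ, -, hμF, C, hC1, hμ⟩ := hF
  have hC0 : 0 < C := one_pos.trans_le hC1
  have hd0 : ediam F ≠ 0 := fun h => (not_subsingleton_iff.2 hFn) (ediam_eq_zero_iff.1 h)
  have hdtop : ediam F ≠ ∞ := hFb.ediam_ne_top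
  have hhalf : ediam F / 2 < ediam F := ENNReal.half_lt_self hd0 hdtop
  have hle : (ENNReal.ofReal C)⁻¹ • μ ≤ μH[s] := by
    refine Measure.le_hausdorffMeasure s _ (ediam F / 2) (ENNReal.half_pos hd0) fun U hU => ?_
    have hC0' : ENNReal.ofReal C ≠ 0 := (ENNReal.ofReal_pos.2 hC0).ne'
    rw [Measure.smul_apply, smul_eq_mul, ENNReal.inv_mul_le_iff hC0' ENNReal.ofReal_ne_top]
    rcases (U ∩ F).eq_empty_or_nonempty with hUF | ⟨x, hxU, hxF⟩
    · rw [measure_mono_null (disjoint_iff_inter_eq_empty.2 hUF).subset_compl_right hμF]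
      exact zero_le
    have hUtop : ediam U ≠ ∞ := ne_top_of_lt (hU.trans_lt hhalf)
    -- Regularity is only available for positive radii, and `U` may have diameter zero; hence radii
    -- slightly above the diameter and a limit.
    have hlim : Tendsto (fun r : ℝ => ENNReal.ofReal (C * r ^ s)) (𝓝[>] (ediam U).toReal)
        (𝓝 (ENNReal.ofReal (C * (ediam U).toReal ^ s))) :=
      ((ENNReal.continuous_ofReal.comp ((Real.continuous_rpow_const hs).const_mul C)).tendsto
        _).mono_left nhdsWithin_le_nhds
    have heq : ENNReal.ofReal (C * (ediam U).toReal ^ s) = ENNReal.ofReal C * ediam U ^ s := by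
      rw [ENNReal.ofReal_mul hC0.le, ← ENNReal.ofReal_rpow_of_nonneg ENNReal.toReal_nonneg hs,
        ENNReal.ofReal_toReal hUtop]
    rw [← heq]
    refine ge_of_tendsto hlim ?_
    have hlt : (ediam U).toReal < (ediam F).toReal :=
      (ENNReal.toReal_lt_toReal hUtop hdtop).2 (hU.trans_lt hhalf)
    filter_upwards [Ioo_mem_nhdsGT hlt] with r hr
    refine (measure_mono fun y hy => ?_).trans (hμ x hxF r (ENNReal.toReal_nonneg.trans_lt hr.1) ?_).2
    · rw [mem_closedBall, dist_edist]
      exact (ENNReal.toReal_mono hUtop (edist_le_ediam_of_mem hy hxU)).trans hr.1.le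
    · exact (ENNReal.ofReal_lt_iff_lt_toReal (ENNReal.toReal_nonneg.trans hr.1.le) hdtop).2 hr.2
  obtain ⟨x, hx⟩ := hFn.nonempty
  have hr0 : 0 < (ediam F / 2).toReal :=
    ENNReal.toReal_pos (ENNReal.half_pos hd0).ne' (ne_top_of_lt hhalf)
  have hpos : 0 < μ F := by
    have h1 := (hμ x hx _ hr0 (by rwa [ENNReal.ofReal_toReal (ne_top_of_lt hhalf)])).1
    refine (ENNReal.ofReal_pos.2 (by positivity)).trans_le (h1.trans ?_)
    calc _ ≤ μ (F ∪ Fᶜ) := measure_mono (by simp)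
      _ ≤ μ F + μ Fᶜ := measure_union_le _ _
      _ = μ F := by rw [hμF, add_zero]
  have hC : (ENNReal.ofReal C)⁻¹ ≠ 0 := ENNReal.inv_ne_zero.2 ENNReal.ofReal_ne_top
  exact (ENNReal.mul_pos hC hpos.ne').trans_le (hle F)

/-- The restriction of `μH[s]` to `F` is the regular measure. A ball of radius `r` contains a copy
of `F` of scale `r / Δ`, which bounds its mass below; the bound `hup` with diameter `2 * r` bounds
it above. -/
theorem isAhlforsRegular_of_hausdorffMeasure (hs : 0 ≤ s) (hFc : IsCompact F) {D : ℝ≥0}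
    (hD : 1 ≤ D) (hQ : IsQuasiSelfSimilar F D) (hup : ∀ V : Set (EuclideanSpace ℝ (Fin d)),
      μH[s] (F ∩ V) ≤ (D : ℝ≥0∞) ^ s * ediam V ^ s)
    (hfin : μH[s] F ≠ ∞) (hpos : 0 < μH[s] F) : IsAhlforsRegular s F := by
  have : IsFiniteMeasure (μH[s].restrict F) := ⟨by simpa using hfin.lt_top⟩
  have hD0 : (0 : ℝ) < D := zero_lt_one.trans_le hD
  obtain ⟨Δ, hΔ0, hΔ⟩ : ∃ Δ : ℝ≥0, 0 < Δ ∧ ediam F ≤ Δ :=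
    ⟨(ediam F).toNNReal + 1, by positivity, by
      rw [ENNReal.coe_add, ENNReal.coe_toNNReal hFc.isBounded.ediam_ne_top]
      exact le_self_add⟩
  have hΔ0' : (0 : ℝ) < Δ := hΔ0
  have hΔF : ∀ x y : F, edist x y ≤ Δ := fun x y => (edist_le_ediam_of_mem x.2 y.2).trans hΔ
  set M := (μH[s] F).toReal with hM
  have hM0 : 0 < M := ENNReal.toReal_pos hpos.ne' hfin
  set C₁ := (D * Δ : ℝ) ^ s / M with hC₁
  have hC₁0 : 0 < C₁ := by positivity
  refine ⟨μH[s].restrict F, inferInstance, ?_, max 1 (max C₁ ((2 * D : ℝ) ^ s)), le_max_left _ _,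
    fun x hx r hr0 hr => ⟨?_, ?_⟩⟩
  · rw [Measure.restrict_apply hFc.measurableSet.compl, compl_inter_self, measure_empty]
  · rw [Measure.restrict_apply isClosed_closedBall.measurableSet, inter_comm]
    set b := μH[s] (F ∩ closedBall x r) with hb
    have hbtop : b ≠ ∞ := ne_top_of_le_ne_top hfin (measure_mono inter_subset_left)
    have hrΔ : r ≤ Δ := by
      have := hr.le.trans hΔ
      rwa [ENNReal.ofReal_le_iff_le_toReal ENNReal.coe_ne_top, ENNReal.coe_toReal] at this
    lift r to ℝ≥0 using hr0.le
    have hr0' : 0 < r := hr0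
    have h := hQ.hausdorffMeasure_univ_le_mul_closedBall hΔF hs ⟨x, hx⟩ (r := r / Δ)
      (div_pos hr0' hΔ0) (div_le_one_of_le₀ hrΔ hΔ0.le)
    have hball : closedBall (⟨x, hx⟩ : F) (((r / Δ : ℝ≥0) : ℝ) * Δ) = (↑) ⁻¹' closedBall x r := by
      rw [NNReal.coe_div, div_mul_cancel₀ _ hΔ0'.ne']
      rfl
    rw [hball, hausdorffMeasure_coe_preimage _ _ hs, ← preimage_univ (f := (Subtype.val : F → _)),
      hausdorffMeasure_coe_preimage _ _ hs, inter_univ, ← hb] at h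
    have h' : M ≤ (D * Δ / r : ℝ) ^ s * b.toReal := by
      have := ENNReal.toReal_mono (ENNReal.mul_ne_top (by finiteness) hbtop) h
      rw [ENNReal.toReal_mul, ← ENNReal.toReal_rpow, ENNReal.coe_toReal] at this
      convert this using 3
      push_cast
      field_simp
    rw [ENNReal.ofReal_le_iff_le_toReal hbtop]
    rw [Real.div_rpow (by positivity) hr0.le, div_mul_eq_mul_div, le_div_iff₀ (by positivity)] at h'
    calc _ ≤ C₁⁻¹ * (r : ℝ) ^ s := by
          gcongr
          exact (le_max_left _ _).trans (le_max_right _ _)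
      _ = M * (r : ℝ) ^ s / (D * Δ : ℝ) ^ s := by rw [hC₁, inv_div]; ring
      _ ≤ _ := by rw [div_le_iff₀ (by positivity), mul_comm b.toReal]; exact h'
  · rw [Measure.restrict_apply isClosed_closedBall.measurableSet, inter_comm]
    refine (hup _).trans ?_
    calc _ ≤ (D : ℝ≥0∞) ^ s * (2 * ENNReal.ofReal r) ^ s := by
          gcongr
          rw [← closedEBall_ofReal hr0.le]
          exact ediam_closedEBall_le
      _ = ENNReal.ofReal ((2 * D : ℝ) ^ s * r ^ s) := by
          rw [← ENNReal.mul_rpow_of_nonneg _ _ hs, ← Real.mul_rpow (by positivity) hr0.le,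
            ← ENNReal.ofReal_rpow_of_nonneg (by positivity) hs, ENNReal.ofReal_mul (by positivity),
            ENNReal.ofReal_mul (by positivity), ENNReal.ofReal_coe_nnreal]
          congr 1
          simp
          ring
      _ ≤ _ := by
          gcongr
          exact (le_max_right _ _).trans (le_max_right _ _)

end AhlforsRegular

theorem theorem3p1 {d : ℕ} (F : Set (EuclideanSpace ℝ (Fin d))) (hF : IsSelfConformal F)
    (s : ℝ) (hs : s = (dimH F).toReal) :
    (∃ C : ℝ, 1 ≤ C ∧ ∀ A : Set (EuclideanSpace ℝ (Fin d)),
      μH[s] (F ∩ A) ≤ ENNReal.ofReal C * hausdorffContent s (F ∩ A)) ∧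
    (0 < μH[s] F ↔ IsAhlforsRegular s F) := by
  obtain ⟨D, hD, hQ⟩ := hF.exists_isQuasiSelfSimilar
  obtain ⟨-, -, -, -, hFne, hFc, -, -⟩ := hF
  have : CompactSpace F := isCompact_iff_compactSpace.1 hFc
  have : Nonempty F := hFne.to_subtype
  have hs0 : 0 ≤ s := hs ▸ ENNReal.toReal_nonneg
  have hdim : dimH (univ : Set F) = s.toNNReal := by
    have htop : dimH F ≠ ∞ := Real.dimH_ne_top F
    rw [← isometry_subtype_coe.dimH_image, image_univ, Subtype.range_coe, hs]
    exact (ENNReal.ofReal_toReal htop).symm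
  have hcoe : (s.toNNReal : ℝ) = s := Real.coe_toNNReal s hs0
  have hup : ∀ V : Set (EuclideanSpace ℝ (Fin d)),
      μH[s] (F ∩ V) ≤ (D : ℝ≥0∞) ^ s * ediam V ^ s := fun V => by
    have h := hQ.hausdorffMeasure_le_mul_ediam_rpow hD hdim ((↑) ⁻¹' V)
    rw [hcoe, hausdorffMeasure_coe_preimage _ _ hs0, ediam_coe_preimage] at h
    exact h.trans (by gcongr; exact inter_subset_right)
  have hfin : μH[s] F ≠ ∞ := by
    have h := hQ.hausdorffMeasure_univ_ne_top hD hdim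
    rwa [hcoe, ← preimage_univ (f := (Subtype.val : F → _)), hausdorffMeasure_coe_preimage _ _ hs0,
      inter_univ] at h
  refine ⟨⟨(D : ℝ) ^ s, Real.one_le_rpow hD hs0, fun A => ?_⟩,
    isAhlforsRegular_of_hausdorffMeasure hs0 hFc hD hQ hup hfin, fun hreg => ?_⟩
  · rw [← ENNReal.ofReal_rpow_of_nonneg D.coe_nonneg hs0, ENNReal.ofReal_coe_nnreal]
    have hD0 : (D : ℝ≥0∞) ≠ 0 := by
      exact_mod_cast (zero_lt_one.trans_le hD).ne'
    refine le_mul_hausdorffContent (ENNReal.rpow_pos (pos_iff_ne_zero.2 hD0) ENNReal.coe_ne_top).ne'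
      (ENNReal.rpow_ne_top_of_nonneg hs0 ENNReal.coe_ne_top) fun V => ?_
    exact (measure_mono (inter_subset_inter_left V inter_subset_left)).trans (hup V)
  -- For a single point no radius lies below the diameter, so regularity is vacuous; positivity then
  -- comes from `s = 0` and the measure `μH[0]` of a non-empty set.
  · rcases F.subsingleton_or_nontrivial with hsub | hnon
    · have : s = 0 := by rw [hs, hsub.dimH_zero, ENNReal.toReal_zero]
      rw [this]
      exact one_pos.trans_le (Measure.one_le_hausdorffMeasure_zero_of_nonempty hFne)
    · exact hreg.hausdorffMeasure_pos hs0 hFc.isBounded hnon
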